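/- Let $T$ be a nonempty compact topological space, let $t\mapsto a_t\in\mathbb{R}^n$ and $t\mapsto b_t\in\mathbb{R}$ be continuous on $T$, and consider the linear system $\langle a_t,x\rangle\le b_t$ for all $t\in T$. Put $\phi(x)=\max_{t\in T}(\langle a_t,x\rangle-b_t)$ and $T(x)=\{t\in T:\langle a_t,x\rangle-b_t=\phi(x)\}$, so that $[\phi\le 0]:=\{y:\phi(y)\le 0\}$ is the solution set of the system. Notation. $d(y,A)=\inf_{z\in A}\|z-y\|$ (Euclidean norm), with $d(y,\emptyset)=+\infty$; $\operatorname{co}$ is the convex hull; $\sigma_A(w)=\sup_{v\in A}\langle v,w\rangle$ is the support function of $A$. For $g:\mathbb{R}^n\to[-\infty,+\infty]$ and a point $x$ with $g(x)$ finite: $\hat\partial g(x)$ is the set of $v$ with $g(y)\ge g(x)+\langle v,y-x\rangle+o(\|y-x\|)$ as $y\to x$; $\partial g(x)$ is the set of limits of sequences $v_k\in\hat\partial g(x_k)$ with $x_k\to x$ and $g(x_k)\to g(x)$; and the outer limiting subdifferential $\partial^>g(x)$ is the set of limits of convergent sequences $v_k\in\partial g(x_k)$ with $x_k\to x$, $g(x_k)\to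 g(x)$ and $g(x_k)>g(x)$ for all $k$. For $g(x)\le 0$, $\operatorname{ebm}(g,x)\in[0,+\infty]$ is the supremum of all $\tau>0$ for which there is a neighborhood $U$ of $x$ with $\tau\, d(y,[g\le 0])\le\max\{g(y),0\}$ for all $y\in U$ (and $0$ if there is no such $\tau$). Let $x$ be a solution of the system at which the following regularity condition holds: there is a neighborhood $V$ of $x$ such that $$\{y:\langle a_t,y\rangle\le b_t\ \forall t\in T\}\cap V=\bigl(x+\{w:\langle a_t,w\rangle\le 0\ \forall t\in T(x)\}\bigr)\cap V.$$ Then $$\operatorname{ebm}(\phi,x)=d\bigl(0,\partial^>\sigma_{\partial\phi(x)}(0)\bigr)=d\Bigl(0,\bigcup_{T'\in\mathcal T(x)}\operatorname{co}\{a_t:t\in T'\}\Bigr),$$ where $$\mathcal T(x)=\{T'\subset T(x):\exists w\in\mathbb{R}^n,\ \langle a_t,w\rangle=1\ \forall t\in T',\ \langle a_t,w\rangle<1\ \forall t\in T(x)\setminus T'\}.$$ If moreover $\phi(x)=0$ (in particular if $x$ lies on the boundary of $[\phi\le 0]$), then also $d(0,\partial^>\phi(x))=\operatorname{ebm}(\phi,x)$,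 so that all four quantities are equal. -/

import Mathlib

open Filter Topology
open scoped ENNReal NNReal

noncomputable section

namespace ErrorBound

variable {E : Type*} [NormedAddCommGroup E] [InnerProductSpace ℝ E]

/-- The support function `σ_A(w) = sup_{x ∈ A} ⟨x, w⟩`, with extended real values. -/
def supportFun (A : Set E) (w : E) : EReal :=
  ⨆ x ∈ A, ((inner ℝ x w : ℝ) : EReal)

/-- The regular (Fréchet) subdifferential of `g` at a point where `g` is finite:
`g y ≥ g x + ⟨v, y - x⟩ + o(‖y - x‖)`. -/
def regularSubdiff (g : E → EReal) (x : E) : Set E :=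
  {v | g x ≠ ⊥ ∧ g x ≠ ⊤ ∧
    ∀ ε : ℝ, 0 < ε → ∀ᶠ y in 𝓝 x,
      g x + ((inner ℝ v (y - x) - ε * ‖y - x‖ : ℝ) : EReal) ≤ g y}

/-- The general (limiting) subdifferential of `g` at a point where `g` is finite. -/
def subdiff (g : E → EReal) (x : E) : Set E :=
  {v | g x ≠ ⊥ ∧ g x ≠ ⊤ ∧
    ∃ (xs vs : ℕ → E), Tendsto xs atTop (𝓝 x) ∧
      Tendsto (fun k => g (xs k)) atTop (𝓝 (g x)) ∧
      Tendsto vs atTop (𝓝 v) ∧ ∀ k, vs k ∈ regularSubdiff g (xs k)}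

/-- The outer limiting subdifferential of `g` at a point where `g` is finite: limits of subgradients
at points `xs k → x` with `g (xs k) → g x` and `g (xs k) > g x`. -/
def outerSubdiff (g : E → EReal) (x : E) : Set E :=
  {v | g x ≠ ⊥ ∧ g x ≠ ⊤ ∧
    ∃ (xs vs : ℕ → E), Tendsto xs atTop (𝓝 x) ∧
      Tendsto (fun k => g (xs k)) atTop (𝓝 (g x)) ∧
      (∀ k, g x < g (xs k)) ∧
      (∀ k, vs k ∈ subdiff g (xs k)) ∧ Tendsto vs atTop (𝓝 v)}

/-- `τ` is a local error bound constant of `g` at `x`: for all `y` near `x`,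
`τ * d(y, [g ≤ 0]) ≤ max (g y) 0`. -/
def IsErrorBoundConst (g : E → EReal) (x : E) (τ : ℝ≥0) : Prop :=
  0 < τ ∧ ∃ U ∈ 𝓝 x, ∀ y ∈ U,
    (τ : ℝ≥0∞) * Metric.infEDist y {z | g z ≤ 0} ≤ (g y).toENNReal

/-- The local error bound modulus: the supremum of all local error bound constants
(`0` if there is none, `⊤` if they are unbounded). -/
def ebm (g : E → EReal) (x : E) : ℝ≥0∞ :=
  ⨆ (τ : ℝ≥0) (_ : IsErrorBoundConst g x τ), (τ : ℝ≥0∞)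

variable {T : Type*}

/-- The function `φ(x) = max_{t ∈ T} (⟨a t, x⟩ - b t)` (the supremum is attained and finite when `T`
is a nonempty compact space and `a`, `b` are continuous). -/
def maxFun (a : T → E) (b : T → ℝ) (x : E) : EReal :=
  ⨆ t, ((inner ℝ (a t) x - b t : ℝ) : EReal)

/-- The active index set `T(x)`. -/
def activeSet (a : T → E) (b : T → ℝ) (x : E) : Set T :=
  {t | ((inner ℝ (a t) x - b t : ℝ) : EReal) = maxFun a b x}

/-- The local regularity condition at `x`: on a neighborhood of `x` the solution set of the system
coincides with the translate by `x` of the cone `{w | ⟨a t, w⟩ ≤ 0 for all t ∈ T(x)}`. -/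
def LocalRegularity (a : T → E) (b : T → ℝ) (x : E) : Prop :=
  ∃ V ∈ 𝓝 x, {y | ∀ t, inner ℝ (a t) y ≤ b t} ∩ V =
    ((fun w => x + w) '' {w | ∀ t ∈ activeSet a b x, inner ℝ (a t) w ≤ 0}) ∩ V

/-- The collection `𝒯(x)` of subsets `T'` of `T(x)` for which some `w` satisfies `⟨a t, w⟩ = 1` on
`T'` and `⟨a t, w⟩ < 1` on `T(x) \ T'`. -/
def faceIndexSets (a : T → E) (b : T → ℝ) (x : E) : Set (Set T) :=
  {T' | T' ⊆ activeSet a b x ∧ ∃ w : E,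
    (∀ t ∈ T', inner ℝ (a t) w = 1) ∧ ∀ t ∈ activeSet a b x \ T', inner ℝ (a t) w < 1}

end ErrorBound

end

/-! The function φ is convex, so its limiting subgradients at `y` are its convex subgradients, which
form the closed convex hull of the gradients active at `y` (`subdiff_maxFun`). When φ(x) = 0, the
modulus is the distance from 0 to the outer subdifferential (`ebm_eq_infEDist_outerSubdiff`). On one
side, a subgradient v at y gives φ(y) ≤ ‖v‖ d(y, [φ ≤ 0]). On the other, if a constant m fails,
penalised minimisation yields subgradients of norm at most m at points outside [φ ≤ 0] tending to x.

The support function σ of ∂φ(x) is again such a maximum, over the active indices and with zero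
right-hand sides, so the same result applies to σ at 0. The moduli of φ and σ agree
(`ebm_eq_ebm_activePart`): by regularity [φ ≤ 0] is x + [σ ≤ 0] near x, while φ(y) ≥ σ(y - x) and
φ(x + sw) is sσ(w) to first order. A point with σ > 0 can be rescaled to σ = 1, where its active set
belongs to 𝒯(x); this gives the union of hulls up to closure. If φ(x) < 0, both the modulus and the
distance to the union are infinite. -/

namespace ErrorBound

set_option linter.unusedSectionVars false

/-! ### Maxima of affine functions: subgradients and error bounds -/

section RealMax

variable {E : Type*} [NormedAddCommGroup E] [InnerProductSpace ℝ E]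
  {T : Type*} [TopologicalSpace T] [CompactSpace T] [Nonempty T] {a : T → E} {b : T → ℝ}

/-- The real-valued maximum `max_{t} (⟨a t, y⟩ - b t)`. -/
noncomputable def realMax (a : T → E) (b : T → ℝ) (y : E) : ℝ :=
  ⨆ t, (inner ℝ (a t) y - b t)

theorem continuous_affine (ha : Continuous a) (hb : Continuous b) (y : E) :
    Continuous fun t => inner ℝ (a t) y - b t := by fun_prop

theorem le_realMax (ha : Continuous a) (hb : Continuous b) (y : E) (t : T) :
    inner ℝ (a t) y - b t ≤ realMax a b y :=
  le_ciSup (isCompact_range (continuous_affine ha hb y)).bddAbove t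

theorem exists_eq_realMax (ha : Continuous a) (hb : Continuous b) (y : E) :
    ∃ t, inner ℝ (a t) y - b t = realMax a b y := by
  obtain ⟨t, -, ht⟩ := isCompact_univ.exists_isMaxOn Set.univ_nonempty
    (continuous_affine ha hb y).continuousOn
  exact ⟨t, le_antisymm (le_realMax ha hb y t) (ciSup_le fun s => ht (Set.mem_univ s))⟩

theorem maxFun_eq_coe (ha : Continuous a) (hb : Continuous b) (y : E) :
    maxFun a b y = (realMax a b y : EReal) := by
  apply le_antisymm
  · exact iSup_le fun t => EReal.coe_le_coe_iff.2 (le_realMax ha hb y t)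
  · obtain ⟨t, ht⟩ := exists_eq_realMax ha hb y
    rw [← ht]
    exact le_iSup (fun t => ((inner ℝ (a t) y - b t : ℝ) : EReal)) t

theorem mem_activeSet (ha : Continuous a) (hb : Continuous b) {y : E} {t : T} :
    t ∈ activeSet a b y ↔ inner ℝ (a t) y - b t = realMax a b y := by
  rw [activeSet, Set.mem_ofPred_eq, maxFun_eq_coe ha hb, EReal.coe_eq_coe_iff]

theorem activeSet_nonempty (ha : Continuous a) (hb : Continuous b) (y : E) :
    (activeSet a b y).Nonempty := by
  obtain ⟨t, ht⟩ := exists_eq_realMax ha hb y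
  exact ⟨t, (mem_activeSet ha hb).2 ht⟩

theorem isClosed_activeSet (ha : Continuous a) (hb : Continuous b) (y : E) :
    IsClosed (activeSet a b y) := by
  have : activeSet a b y = {t | inner ℝ (a t) y - b t = realMax a b y} := by
    ext t; exact mem_activeSet ha hb
  rw [this]
  exact isClosed_eq (continuous_affine ha hb y) continuous_const

theorem exists_norm_bound (ha : Continuous a) : ∃ M : ℝ≥0, ∀ t, ‖a t‖ ≤ M := by
  obtain ⟨M, hM⟩ := (isCompact_range ha.norm).bddAbove
  refine ⟨⟨max M 0, le_max_right _ _⟩, fun t => (hM ⟨t, rfl⟩).trans (le_max_left _ _)⟩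

theorem continuous_realMax (ha : Continuous a) (hb : Continuous b) :
    Continuous (realMax a b) := by
  obtain ⟨M, hM⟩ := exists_norm_bound ha
  refine (LipschitzWith.of_le_add_mul (f := realMax a b) M fun y z =>
    ciSup_le fun t => ?_).continuous
  have h1 := le_realMax ha hb z t
  have h2 := real_inner_le_norm (a t) (y - z)
  have h3 := mul_le_mul_of_nonneg_right (hM t) (norm_nonneg (y - z))
  rw [inner_sub_right] at h2
  rw [dist_eq_norm]
  linarith

theorem realMax_convex_comb_le (ha : Continuous a) (hb : Continuous b) (y z : E) {s : ℝ}
    (hs : 0 ≤ s) (hs1 : s ≤ 1) :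
    realMax a b (y + s • (z - y)) ≤ realMax a b y + s * (realMax a b z - realMax a b y) := by
  refine ciSup_le fun t => ?_
  have h1 := mul_le_mul_of_nonneg_left (le_realMax ha hb z t) hs
  have h2 := mul_le_mul_of_nonneg_left (le_realMax ha hb y t) (sub_nonneg.2 hs1)
  rw [inner_add_right, inner_smul_right, inner_sub_right]
  linarith

/-- The directional derivative of a maximum is at most the maximum over the active indices. -/
theorem eventually_realMax_add_smul_le (ha : Continuous a) (hb : Continuous b) {y d : E} {c : ℝ}
    (h : ∀ t ∈ activeSet a b y, inner ℝ (a t) d < c) :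
    ∀ᶠ s : ℝ in 𝓝[>] 0, realMax a b (y + s • d) ≤ realMax a b y + s * c := by
  have hB : IsCompact {t | c ≤ inner ℝ (a t) d} :=
    (isClosed_le continuous_const (by fun_prop)).isCompact
  -- The indices with slope at least `c` form a compact set without active indices, so they have a
  -- uniform slack `δ`.
  obtain ⟨δ, hδ, hδB⟩ : ∃ δ > 0, ∀ t, c ≤ inner ℝ (a t) d →
      inner ℝ (a t) y - b t ≤ realMax a b y - δ := by
    rcases Set.eq_empty_or_nonempty {t | c ≤ inner ℝ (a t) d} with he | hne
    · refine ⟨1, one_pos, fun t ht => ?_⟩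
      exact absurd (show t ∈ {t | c ≤ inner ℝ (a t) d} from ht) (by simp [he])
    · obtain ⟨t, ht, hmax⟩ := hB.exists_isMaxOn hne (continuous_affine ha hb y).continuousOn
      refine ⟨realMax a b y - (inner ℝ (a t) y - b t), ?_, fun t' ht' => ?_⟩
      · rw [gt_iff_lt, sub_pos]
        refine lt_of_le_of_ne (le_realMax ha hb y t) fun heq => ?_
        exact absurd (h t ((mem_activeSet ha hb).2 heq)) (not_lt.2 ht)
      · have := hmax ht'
        simp only [Set.mem_ofPred_eq] at this
        linarith
  obtain ⟨M, hM⟩ := exists_norm_bound ha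
  have hlim : Tendsto (fun s : ℝ => s * (M * ‖d‖ - c)) (𝓝[>] 0) (𝓝 0) := by
    have : Continuous fun s : ℝ => s * (M * ‖d‖ - c) := by fun_prop
    simpa using (this.tendsto 0).mono_left nhdsWithin_le_nhds
  filter_upwards [hlim.eventually (gt_mem_nhds hδ), self_mem_nhdsWithin] with s hs hs0
  have hs0' : 0 < s := hs0
  refine ciSup_le fun t => ?_
  rw [inner_add_right, inner_smul_right]
  rcases le_or_gt c (inner ℝ (a t) d) with hc | hc
  · have h1 := hδB t hc
    have h2 : inner ℝ (a t) d ≤ M * ‖d‖ := (real_inner_le_norm (a t) d).trans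
      (mul_le_mul_of_nonneg_right (hM t) (norm_nonneg d))
    have h3 := mul_le_mul_of_nonneg_left h2 hs0'.le
    linarith
  · have h1 := le_realMax ha hb y t
    have h3 := mul_le_mul_of_nonneg_left hc.le hs0'.le
    linarith

/-- The closed convex hull of the `a t` over the active indices at `y`. -/
def faceHull (a : T → E) (b : T → ℝ) (y : E) : Set E :=
  closure (convexHull ℝ (a '' activeSet a b y))

theorem exists_min_inner_faceHull [CompleteSpace E] (ha : Continuous a) (hb : Continuous b)
    (y v : E) : ∃ p ∈ faceHull a b y, ∀ w ∈ faceHull a b y, inner ℝ (v - p) (w - p) ≤ 0 := by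
  have hne : (faceHull a b y).Nonempty :=
    (((activeSet_nonempty ha hb y).image a).convexHull).closure
  have hconv : Convex ℝ (faceHull a b y) := (convex_convexHull ℝ _).closure
  obtain ⟨p, hp, hmin⟩ := exists_norm_eq_iInf_of_complete_convex hne
    (isClosed_closure.isComplete) hconv v
  exact ⟨p, hp, (norm_eq_iInf_iff_real_inner_le_zero hconv hp).1 hmin⟩

theorem mem_faceHull_of_mem_activeSet {y : E} {t : T} (ht : t ∈ activeSet a b y) :
    a t ∈ faceHull a b y :=
  subset_closure (subset_convexHull ℝ _ ⟨t, ht, rfl⟩)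

theorem faceHull_subset {y : E} {A : Set E} (hA : IsClosed A) (hc : Convex ℝ A)
    (h : ∀ t ∈ activeSet a b y, a t ∈ A) : faceHull a b y ⊆ A := by
  refine closure_minimal (convexHull_min ?_ hc) hA
  rintro _ ⟨t, ht, rfl⟩
  exact h t ht

/-- `v` is a subgradient of the maximum at `y` in the sense of convex analysis. -/
def IsSubgradient (a : T → E) (b : T → ℝ) (y v : E) : Prop :=
  ∀ z, realMax a b y + inner ℝ v (z - y) ≤ realMax a b z

theorem isClosed_isSubgradient (y : E) : IsClosed {v | IsSubgradient a b y v} := by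
  simp only [IsSubgradient, Set.ofPred_forall]
  exact isClosed_iInter fun z => isClosed_le (by fun_prop) continuous_const

theorem convex_isSubgradient (y : E) : Convex ℝ {v | IsSubgradient a b y v} := by
  intro v hv w hw r s hr hs hrs z
  have h1 := mul_le_mul_of_nonneg_left (hv z) hr
  have h2 := mul_le_mul_of_nonneg_left (hw z) hs
  rw [inner_add_left, real_inner_smul_left, real_inner_smul_left]
  have hs' : s = 1 - r := by linarith
  subst hs'
  linarith

/-- Separation by projection: if `p` is the projection of `v` onto the hull, the directional
derivative along `v - p` forces `v = p`. -/
theorem isSubgradient_iff_mem_faceHull [CompleteSpace E] (ha : Continuous a) (hb : Continuous b)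
    {y v : E} : IsSubgradient a b y v ↔ v ∈ faceHull a b y := by
  constructor
  · intro hv
    obtain ⟨p, hp, hmin⟩ := exists_min_inner_faceHull ha hb y v
    have key : inner ℝ v (v - p) ≤ inner ℝ p (v - p) := by
      refine le_of_forall_gt_imp_ge_of_dense fun c hc => ?_
      have hact : ∀ t ∈ activeSet a b y, inner ℝ (a t) (v - p) < c := by
        intro t ht
        have := hmin _ (mem_faceHull_of_mem_activeSet ht)
        rw [inner_sub_right, real_inner_comm, real_inner_comm p] at this
        linarith
      obtain ⟨s, hs, hs0⟩ :=
        ((eventually_realMax_add_smul_le ha hb hact).and self_mem_nhdsWithin).exists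
      have h1 := hv (y + s • (v - p))
      rw [add_sub_cancel_left, inner_smul_right] at h1
      have hs0' : 0 < s := hs0
      exact le_of_mul_le_mul_left (by linarith) hs0'
    have : inner ℝ (v - p) (v - p) ≤ 0 := by
      rw [inner_sub_left (v) p]; linarith
    have : v - p = 0 := real_inner_self_nonpos.1 this
    rwa [sub_eq_zero.1 this]
  · intro hv
    refine faceHull_subset (isClosed_isSubgradient y) (convex_isSubgradient y) ?_ hv
    intro t ht z
    have h1 := (mem_activeSet ha hb).1 ht
    have h2 := le_realMax ha hb z t
    rw [inner_sub_right]
    linarith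

theorem IsSubgradient.mem_regularSubdiff (ha : Continuous a) (hb : Continuous b) {y v : E}
    (h : IsSubgradient a b y v) : v ∈ regularSubdiff (maxFun a b) y := by
  simp only [regularSubdiff, maxFun_eq_coe ha hb, Set.mem_ofPred_eq]
  refine ⟨EReal.coe_ne_bot _, EReal.coe_ne_top _, fun ε hε => Eventually.of_forall fun z => ?_⟩
  rw [← EReal.coe_add, EReal.coe_le_coe_iff]
  have := h z
  have := mul_nonneg hε.le (norm_nonneg (z - y))
  linarith

/-- Convexity along the segment from `y` to `z` turns the local estimate into a global one, with an
error `ε` that is then sent to 0. -/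
theorem isSubgradient_of_mem_regularSubdiff (ha : Continuous a) (hb : Continuous b) {y v : E}
    (h : v ∈ regularSubdiff (maxFun a b) y) : IsSubgradient a b y v := by
  simp only [regularSubdiff, maxFun_eq_coe ha hb, Set.mem_ofPred_eq] at h
  intro z
  have key : ∀ ε : ℝ, 0 < ε →
      realMax a b y + inner ℝ v (z - y) ≤ realMax a b z + ε * ‖z - y‖ := by
    intro ε hε
    have hev := h.2.2 ε hε
    have hlim : Tendsto (fun s : ℝ => y + s • (z - y)) (𝓝[>] 0) (𝓝 y) := by
      have : Continuous fun s : ℝ => y + s • (z - y) := by fun_prop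
      simpa using (this.tendsto 0).mono_left nhdsWithin_le_nhds
    have h1 : ∀ᶠ s : ℝ in 𝓝[>] 0, s < 1 :=
      nhdsWithin_le_nhds (gt_mem_nhds one_pos)
    obtain ⟨s, hs, hs1, hs0⟩ := ((hlim.eventually hev).and (h1.and self_mem_nhdsWithin)).exists
    have hs0' : 0 < s := hs0
    rw [← EReal.coe_add, EReal.coe_le_coe_iff, add_sub_cancel_left, inner_smul_right, norm_smul,
      Real.norm_of_nonneg hs0'.le] at hs
    have h2 := realMax_convex_comb_le ha hb y z hs0'.le hs1.le
    refine le_of_mul_le_mul_left ?_ hs0'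
    linarith
  have hlim : Tendsto (fun ε : ℝ => realMax a b z + ε * ‖z - y‖) (𝓝[>] 0)
      (𝓝 (realMax a b z)) := by
    have : Continuous fun ε : ℝ => realMax a b z + ε * ‖z - y‖ := by fun_prop
    simpa using (this.tendsto 0).mono_left nhdsWithin_le_nhds
  exact ge_of_tendsto hlim (by filter_upwards [self_mem_nhdsWithin] with ε hε using key ε hε)

theorem mem_subdiff_iff_isSubgradient (ha : Continuous a) (hb : Continuous b) {y v : E} :
    v ∈ subdiff (maxFun a b) y ↔ IsSubgradient a b y v := by
  constructor
  · rintro ⟨-, -, xs, vs, hxs, -, hvs, hreg⟩ z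
    have hc := continuous_realMax ha hb
    refine le_of_tendsto (f := fun k => realMax a b (xs k) + inner ℝ (vs k) (z - xs k))
      (((hc.tendsto y).comp hxs).add (hvs.inner (tendsto_const_nhds.sub hxs)))
      (Eventually.of_forall fun k => isSubgradient_of_mem_regularSubdiff ha hb (hreg k) z)
  · intro h
    have hr := h.mem_regularSubdiff ha hb
    exact ⟨hr.1, hr.2.1, fun _ => y, fun _ => v, tendsto_const_nhds, tendsto_const_nhds,
      tendsto_const_nhds, fun _ => hr⟩

theorem subdiff_maxFun [CompleteSpace E] (ha : Continuous a) (hb : Continuous b) (y : E) :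
    subdiff (maxFun a b) y = faceHull a b y := by
  ext v
  rw [mem_subdiff_iff_isSubgradient ha hb, isSubgradient_iff_mem_faceHull ha hb]

theorem mem_outerSubdiff_maxFun (ha : Continuous a) (hb : Continuous b) {y v : E} :
    v ∈ outerSubdiff (maxFun a b) y ↔ ∃ xs vs : ℕ → E, Tendsto xs atTop (𝓝 y) ∧
      (∀ k, realMax a b y < realMax a b (xs k)) ∧ (∀ k, IsSubgradient a b (xs k) (vs k)) ∧
      Tendsto vs atTop (𝓝 v) := by
  simp only [outerSubdiff, mem_subdiff_iff_isSubgradient ha hb, Set.mem_ofPred_eq,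
    maxFun_eq_coe ha hb, EReal.coe_lt_coe_iff]
  constructor
  · rintro ⟨-, -, xs, vs, h1, -, h3, h4, h5⟩
    exact ⟨xs, vs, h1, h3, h4, h5⟩
  · rintro ⟨xs, vs, h1, h3, h4, h5⟩
    exact ⟨EReal.coe_ne_bot _, EReal.coe_ne_top _, xs, vs, h1,
      (EReal.tendsto_coe.2 (((continuous_realMax ha hb).tendsto y).comp h1)), h3, h4, h5⟩

/-- Fermat's rule for a maximum perturbed by a multiple of the norm. -/
theorem exists_isSubgradient_norm_le [CompleteSpace E] (ha : Continuous a) (hb : Continuous b)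
    {y : E} {m : ℝ} (hm : 0 ≤ m)
    (h : ∀ᶠ z in 𝓝 y, realMax a b y ≤ realMax a b z + m * ‖z - y‖) :
    ∃ v, IsSubgradient a b y v ∧ ‖v‖ ≤ m := by
  obtain ⟨p, hp, hmin⟩ := exists_min_inner_faceHull ha hb y 0
  refine ⟨p, (isSubgradient_iff_mem_faceHull ha hb).2 hp, ?_⟩
  by_contra! hlt
  have hpos : 0 < ‖p‖ := hm.trans_lt hlt
  obtain ⟨c, hc, hcm⟩ : ∃ c, (∀ t ∈ activeSet a b y, inner ℝ (a t) (-p) < c) ∧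
      c < -(m * ‖p‖) := by
    -- Active slopes along `-p` are at most `-‖p‖ ^ 2`; the midpoint lies strictly between this and
    -- `-(m * ‖p‖)`.
    refine ⟨-(((m + ‖p‖) / 2) * ‖p‖), fun t ht => ?_, by nlinarith⟩
    have h1 := hmin _ (mem_faceHull_of_mem_activeSet ht)
    rw [zero_sub, inner_neg_left, inner_sub_right, real_inner_self_eq_norm_sq,
      real_inner_comm] at h1
    rw [inner_neg_right]
    nlinarith
  have hlim : Tendsto (fun s : ℝ => y + s • (-p)) (𝓝[>] 0) (𝓝 y) := by
    have : Continuous fun s : ℝ => y + s • (-p) := by fun_prop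
    simpa using (this.tendsto 0).mono_left nhdsWithin_le_nhds
  obtain ⟨s, ⟨hs1, hs2⟩, hs0⟩ := ((hlim.eventually h).and
    (eventually_realMax_add_smul_le ha hb hc) |>.and self_mem_nhdsWithin).exists
  have hs0' : 0 < s := hs0
  rw [add_sub_cancel_left, norm_smul, Real.norm_of_nonneg hs0'.le, norm_neg] at hs1
  have := mul_lt_mul_of_pos_left hcm hs0'
  linarith

/-- If the error bound with constant `m` fails at `w`, a penalised minimisation yields a
point outside the solution set carrying a subgradient of norm at most `m`. -/
theorem exists_isSubgradient_of_errorBound_fails [FiniteDimensional ℝ E] (ha : Continuous a)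
    (hb : Continuous b) {x w : E} {m : ℝ} (hm : 0 ≤ m) (hx : realMax a b x ≤ 0)
    (hw : max (realMax a b w) 0 < m * Metric.infDist w {z | realMax a b z ≤ 0}) :
    ∃ y v, dist y w ≤ dist x w ∧ 0 < realMax a b y ∧ IsSubgradient a b y v ∧ ‖v‖ ≤ m := by
  have : ProperSpace E := FiniteDimensional.proper ℝ E
  have : CompleteSpace E := FiniteDimensional.complete ℝ E
  have hφ := continuous_realMax ha hb
  set f : E → ℝ := fun z => max (realMax a b z) 0 + m * dist z w with hf
  have hfc : Continuous f := by fun_prop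
  obtain ⟨y, hy, hmin⟩ := (isCompact_closedBall w (dist x w)).exists_isMinOn
    ⟨x, Metric.mem_closedBall.2 le_rfl⟩ hfc.continuousOn
  have hfx : f x = m * dist x w := by simp [hf, max_eq_right hx]
  have hglob : ∀ z, f y ≤ f z := by
    intro z
    rcases le_or_gt (dist z w) (dist x w) with hz | hz
    · exact hmin (Metric.mem_closedBall.2 hz)
    · calc f y ≤ f x := hmin (Metric.mem_closedBall.2 le_rfl)
        _ = m * dist x w := hfx
        _ ≤ m * dist z w := mul_le_mul_of_nonneg_left hz.le hm
        _ ≤ f z := le_add_of_nonneg_left (le_max_right _ _)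
  -- Otherwise `m * infDist w _ ≤ m * dist w y = f y ≤ f w = max (realMax a b w) 0`, against `hw`.
  have hypos : 0 < realMax a b y := by
    by_contra! hle
    have h1 : Metric.infDist w {z | realMax a b z ≤ 0} ≤ dist w y :=
      Metric.infDist_le_dist_of_mem hle
    have h2 := mul_le_mul_of_nonneg_left h1 hm
    have h3 := hglob w
    simp only [hf, max_eq_right hle, dist_self, mul_zero, add_zero, zero_add] at h3
    rw [dist_comm] at h2
    linarith
  have hloc : ∀ᶠ z in 𝓝 y, realMax a b y ≤ realMax a b z + m * ‖z - y‖ := by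
    filter_upwards [(hφ.tendsto y).eventually (lt_mem_nhds hypos)] with z hz
    have h1 := hglob z
    simp only [hf, max_eq_left hz.le, max_eq_left hypos.le] at h1
    have h2 := mul_le_mul_of_nonneg_left (dist_triangle z y w) hm
    rw [← dist_eq_norm]
    linarith
  obtain ⟨v, hv, hvm⟩ := exists_isSubgradient_norm_le ha hb hm hloc
  exact ⟨y, v, Metric.mem_closedBall.1 hy, hypos, hv, hvm⟩

theorem isErrorBoundConst_maxFun_iff (ha : Continuous a) (hb : Continuous b) {x : E}
    (hx : realMax a b x ≤ 0) {τ : ℝ≥0} :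
    IsErrorBoundConst (maxFun a b) x τ ↔ 0 < τ ∧ ∀ᶠ y in 𝓝 x,
      τ * Metric.infDist y {z | realMax a b z ≤ 0} ≤ max (realMax a b y) 0 := by
  have hset : {z | maxFun a b z ≤ 0} = {z | realMax a b z ≤ 0} := by
    ext z; simp [maxFun_eq_coe ha hb]
  have hpt : ∀ y, (τ : ℝ≥0∞) * Metric.infEDist y {z | maxFun a b z ≤ 0} ≤
      (maxFun a b y).toENNReal ↔
        τ * Metric.infDist y {z | realMax a b z ≤ 0} ≤ max (realMax a b y) 0 := by
    intro y
    have hne : Metric.infEDist y {z | realMax a b z ≤ 0} ≠ ⊤ := Metric.infEDist_ne_top ⟨x, hx⟩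
    rw [hset, maxFun_eq_coe ha hb, EReal.real_coe_toENNReal, Metric.infDist,
      ← ENNReal.toReal_le_toReal (ENNReal.mul_ne_top ENNReal.coe_ne_top hne)
        ENNReal.ofReal_ne_top, ENNReal.toReal_mul, ENNReal.coe_toReal, ENNReal.toReal_ofReal']
  simp only [IsErrorBoundConst, hpt, Filter.eventually_iff_exists_mem]

/-- The local error bound modulus of a maximum of affine functions is the distance from the origin
to the outer limiting subdifferential. -/
theorem ebm_eq_infEDist_outerSubdiff [FiniteDimensional ℝ E] (ha : Continuous a)
    (hb : Continuous b) {x : E} (hx : realMax a b x = 0) :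
    ebm (maxFun a b) x = Metric.infEDist 0 (outerSubdiff (maxFun a b) x) := by
  have : ProperSpace E := FiniteDimensional.proper ℝ E
  apply le_antisymm
  · refine iSup₂_le fun τ hτ => Metric.le_infEDist.2 fun v hv => ?_
    obtain ⟨hτ0, hτ⟩ := (isErrorBoundConst_maxFun_iff ha hb hx.le).1 hτ
    obtain ⟨xs, vs, hxs, hpos, hsub, hvs⟩ := (mem_outerSubdiff_maxFun ha hb).1 hv
    have key : (τ : ℝ) ≤ ‖v‖ := by
      refine ge_of_tendsto hvs.norm ?_
      filter_upwards [hxs.eventually hτ] with k hk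
      have hp := hpos k
      rw [hx] at hp
      rw [max_eq_left hp.le] at hk
      have h1 : realMax a b (xs k) ≤ ‖vs k‖ * Metric.infDist (xs k) {z | realMax a b z ≤ 0} := by
        -- A zero subgradient would make `xs k` a global minimiser, although `x` has a smaller
        -- value.
        rcases (norm_nonneg (vs k)).eq_or_lt with h0 | h0
        · have h2 := hsub k x
          rw [norm_eq_zero.1 h0.symm, inner_zero_left] at h2
          linarith
        · rw [← div_le_iff₀' h0]
          refine (Metric.le_infDist ⟨x, hx.le⟩).2 fun z hz => ?_
          rw [div_le_iff₀' h0]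
          have h2 := hsub k z
          have h3 := neg_le_of_abs_le (abs_real_inner_le_norm (vs k) (z - xs k))
          rw [dist_comm, dist_eq_norm]
          simp only [Set.mem_ofPred_eq] at hz
          linarith
      by_contra! hlt
      have h2 := mul_le_mul_of_nonneg_right hlt.le
        (Metric.infDist_nonneg (x := xs k) (s := {z | realMax a b z ≤ 0}))
      have hd : 0 < Metric.infDist (xs k) {z | realMax a b z ≤ 0} := by
        refine lt_of_le_of_ne Metric.infDist_nonneg fun h0 => ?_
        rw [← h0, mul_zero] at h1
        linarith
      have h3 := mul_lt_mul_of_pos_right hlt hd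
      linarith
    rw [edist_comm, edist_zero_right, enorm_eq_nnnorm, ENNReal.coe_le_coe]
    exact key
  · refine le_of_forall_lt fun c hc => ?_
    obtain ⟨m, hcm, hm⟩ := ENNReal.lt_iff_exists_nnreal_btwn.1 hc
    have hm0 : 0 < m := by
      rw [← ENNReal.coe_pos]; exact lt_of_le_of_lt zero_le hcm
    refine hcm.trans_le (le_iSup₂_of_le m
      ((isErrorBoundConst_maxFun_iff ha hb hx.le).2 ⟨hm0, ?_⟩) le_rfl)
    by_contra hnot
    rw [not_eventually] at hnot
    obtain ⟨ws, hws, hfail⟩ := exists_seq_forall_of_frequently hnot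
    simp only [not_le] at hfail
    choose y v hyw hy0 hv hvm using fun k =>
      exists_isSubgradient_of_errorBound_fails ha hb m.2 hx.le (hfail k)
    have hy : Tendsto y atTop (𝓝 x) := by
      have h1 : Tendsto (fun k => dist x (ws k)) atTop (𝓝 0) := by
        simpa using (tendsto_const_nhds (x := x)).dist hws
      have h2 := squeeze_zero (fun k => dist_nonneg) hyw h1
      rw [tendsto_iff_dist_tendsto_zero]
      refine squeeze_zero (fun k => dist_nonneg) (fun k => dist_triangle_right _ _ (ws k)) ?_
      simpa using h2.add h1
    obtain ⟨u, hu, φ, hφ, hlim⟩ := tendsto_subseq_of_bounded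
      (Metric.isBounded_closedBall (x := (0 : E)) (r := m)) (x := v)
      (fun k => by simpa using hvm k)
    rw [Metric.isClosed_closedBall.closure_eq, mem_closedBall_zero_iff] at hu
    have hmem : u ∈ outerSubdiff (maxFun a b) x :=
      (mem_outerSubdiff_maxFun ha hb).2 ⟨y ∘ φ, v ∘ φ, hy.comp hφ.tendsto_atTop,
        fun k => by rw [hx]; exact hy0 _, fun k => hv _, hlim⟩
    have h1 := Metric.infEDist_le_edist_of_mem (x := (0 : E)) hmem
    rw [edist_comm, edist_zero_right, enorm_eq_nnnorm] at h1
    have h2 : (‖u‖₊ : ℝ≥0∞) ≤ m := ENNReal.coe_le_coe.2 hu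
    exact absurd hm (not_lt.2 (h1.trans h2))

end RealMax

/-! ### The support function, its faces, and the regularity condition -/

section Regularity

variable {E : Type*} [NormedAddCommGroup E] [InnerProductSpace ℝ E]
  {T : Type*} [TopologicalSpace T] [CompactSpace T] [Nonempty T] {a : T → E} {b : T → ℝ}

/-- The restriction of `a` to the indices active at `x`. -/
def activePart (a : T → E) (b : T → ℝ) (x : E) (t : activeSet a b x) : E := a t

theorem continuous_activePart (ha : Continuous a) (x : E) : Continuous (activePart a b x) :=
  ha.comp continuous_subtype_val

theorem supportFun_faceHull (a : T → E) (b : T → ℝ) (x : E) :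
    supportFun (faceHull a b x) = maxFun (activePart a b x) (fun _ => 0) := by
  funext w
  apply le_antisymm
  · refine iSup₂_le fun v hv => ?_
    rcases eq_or_ne (maxFun (activePart a b x) (fun _ => 0) w) ⊤ with htop | htop
    · rw [htop]; exact le_top
    -- The value `⊥` means that no index is active, and then the hull is empty.
    rcases eq_or_ne (maxFun (activePart a b x) (fun _ => 0) w) ⊥ with hbot | hbot
    · have hemp : activeSet a b x = ∅ := by
        refine Set.eq_empty_of_forall_notMem fun t ht => ?_
        have := le_iSup (fun t : activeSet a b x =>
          ((inner ℝ (activePart a b x t) w - 0 : ℝ) : EReal)) ⟨t, ht⟩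
        exact EReal.coe_ne_bot _ (le_bot_iff.1 (this.trans hbot.le))
      simp [faceHull, hemp] at hv
    lift maxFun (activePart a b x) (fun _ => 0) w to ℝ using ⟨htop, hbot⟩ with r hr
    rw [EReal.coe_le_coe_iff]
    refine faceHull_subset (A := {v | inner ℝ v w ≤ r})
      (isClosed_le (by fun_prop) continuous_const)
      (convex_halfSpace_le ⟨fun u v => inner_add_left u v w,
        fun c v => real_inner_smul_left v w c⟩ r) (fun t ht => ?_) hv
    have := le_iSup (fun t : activeSet a b x =>
      ((inner ℝ (activePart a b x t) w - 0 : ℝ) : EReal)) ⟨t, ht⟩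
    have h2 := this.trans hr.ge
    rwa [EReal.coe_le_coe_iff, sub_zero] at h2
  · refine iSup_le fun t => ?_
    rw [sub_zero]
    exact le_iSup₂ (f := fun v (_ : v ∈ faceHull a b x) => ((inner ℝ v w : ℝ) : EReal)) (a t)
      (mem_faceHull_of_mem_activeSet t.2)

section Sublinear

variable {c : T → E}

theorem inner_le_realMax_zero (hc : Continuous c) (w : E) (t : T) :
    inner ℝ (c t) w ≤ realMax c (fun _ => 0) w := by
  simpa using le_realMax (b := fun _ => 0) hc continuous_const w t

theorem realMax_zero_le {w : E} {r : ℝ} (h : ∀ t, inner ℝ (c t) w ≤ r) :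
    realMax c (fun _ => 0) w ≤ r :=
  ciSup_le fun t => by simpa using h t

theorem realMax_zero_apply_zero : realMax c (fun _ => 0) 0 = 0 := by
  simp [realMax]

end Sublinear

theorem infEDist_outerSubdiff_activePart [CompleteSpace E] (ha : Continuous a)
    (hb : Continuous b) (x : E) :
    Metric.infEDist 0 (outerSubdiff (maxFun (activePart a b x) (fun _ => 0)) 0) =
      Metric.infEDist 0 (⋃ T' ∈ faceIndexSets a b x, convexHull ℝ (a '' T')) := by
  have : CompactSpace (activeSet a b x) :=
    isCompact_iff_compactSpace.1 (isClosed_activeSet ha hb x).isCompact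
  have : Nonempty (activeSet a b x) := (activeSet_nonempty ha hb x).to_subtype
  have hc := continuous_activePart (b := b) ha x
  have h0 : Continuous fun _ : activeSet a b x => (0 : ℝ) := continuous_const
  apply le_antisymm
  · refine Metric.infEDist_anti fun v hv => ?_
    simp only [Set.mem_iUnion] at hv
    obtain ⟨T', ⟨hT', w, hw1, hw2⟩, hv⟩ := hv
    -- The empty set may belong to `faceIndexSets`, but its hull is empty; an element is needed for
    -- σ(w) > 0.
    obtain ⟨t, ht⟩ : T'.Nonempty := by
      rw [← Set.image_nonempty (f := a), ← convexHull_nonempty_iff (𝕜 := ℝ)]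
      exact ⟨v, hv⟩
    have hpos : ∀ k : ℕ, (0 : ℝ) < 1 / ((k : ℝ) + 1) := fun k => Nat.one_div_pos_of_nat
    -- By homogeneity `v` is a subgradient of σ at every positive multiple of `w`; these shrink to
    -- 0.
    refine (mem_outerSubdiff_maxFun hc h0).2
      ⟨fun k => (1 / ((k : ℝ) + 1)) • w, fun _ => v, ?_, fun k => ?_, fun k => ?_,
        tendsto_const_nhds⟩
    · simpa using (tendsto_one_div_add_atTop_nhds_zero_nat (𝕜 := ℝ)).smul_const w
    · rw [realMax_zero_apply_zero]
      refine lt_of_lt_of_le ?_ (inner_le_realMax_zero hc _ ⟨t, hT' ht⟩)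
      change 0 < inner ℝ (a t) _
      rw [inner_smul_right, hw1 t ht, mul_one]
      exact hpos k
    · refine convexHull_min ?_ (convex_isSubgradient _) hv
      rintro _ ⟨t', ht', rfl⟩ z
      have h1 : inner ℝ (a t') z ≤ _ := inner_le_realMax_zero hc z ⟨t', hT' ht'⟩
      have h2 : realMax (activePart a b x) (fun _ => 0) ((1 / ((k : ℝ) + 1)) • w) ≤
          1 / ((k : ℝ) + 1) := by
        refine realMax_zero_le fun u => ?_
        change inner ℝ (a u) _ ≤ _
        rw [inner_smul_right]
        refine mul_le_of_le_one_right (hpos k).le ?_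
        by_cases hu : (u : T) ∈ T'
        · exact (hw1 u hu).le
        · exact (hw2 u ⟨u.2, hu⟩).le
      rw [inner_sub_right, inner_smul_right, hw1 t' ht']
      linarith
  -- Outer subgradients are limits of points of closed hulls, so only the closure of the union
  -- contains them; the distance is the same.
  · rw [← Metric.infEDist_closure (s := ⋃ T' ∈ faceIndexSets a b x, _)]
    refine Metric.infEDist_anti fun v hv => ?_
    obtain ⟨xs, vs, -, hpos, hsub, hvs⟩ := (mem_outerSubdiff_maxFun hc h0).1 hv
    refine isClosed_closure.mem_of_tendsto hvs (Eventually.of_forall fun k => ?_)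
    have hr := hpos k
    rw [realMax_zero_apply_zero] at hr
    set r := realMax (activePart a b x) (fun _ => 0) (xs k) with hrdef
    refine closure_mono ?_ ((isSubgradient_iff_mem_faceHull hc h0).1 (hsub k))
    refine Set.Subset.trans (convexHull_mono ?_) (Set.subset_biUnion_of_mem
      (u := fun T' : Set T => convexHull ℝ (a '' T'))
      (x := {t | t ∈ activeSet a b x ∧ inner ℝ (a t) (r⁻¹ • xs k) = 1}) ?_)
    · rintro _ ⟨t, ht, rfl⟩
      refine ⟨t, ⟨t.2, ?_⟩, rfl⟩
      have h1 : inner ℝ (a t) (xs k) - 0 = r := (mem_activeSet hc h0).1 ht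
      rw [sub_zero] at h1
      rw [inner_smul_right, h1, inv_mul_cancel₀ hr.ne']
    · refine ⟨fun t ht => ht.1, r⁻¹ • xs k, fun t ht => ht.2, fun t ht => ?_⟩
      refine lt_of_le_of_ne ?_ fun heq => ht.2 ⟨ht.1, heq⟩
      have h1 : inner ℝ (a t) (xs k) ≤ r := inner_le_realMax_zero hc (xs k) ⟨t, ht.1⟩
      rw [inner_smul_right, inv_mul_le_iff₀ hr, mul_one]
      exact h1

/-- Sets that agree near a common point have the same distance function near that point. -/
theorem eventually_infDist_eq {X : Type*} [PseudoMetricSpace X] {x : X} {S S' V : Set X}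
    (hV : V ∈ 𝓝 x) (hS : x ∈ S) (hS' : x ∈ S') (h : S ∩ V = S' ∩ V) :
    ∀ᶠ y in 𝓝 x, Metric.infDist y S = Metric.infDist y S' := by
  obtain ⟨r, hr, hball⟩ := Metric.mem_nhds_iff.1 hV
  have key : ∀ {A B : Set X}, x ∈ A → x ∈ B → A ∩ V = B ∩ V → ∀ y ∈ Metric.ball x (r / 2),
      Metric.infDist y A ≤ Metric.infDist y B := by
    intro A B hA hB hAB y hy
    refine (Metric.le_infDist ⟨x, hB⟩).2 fun z hz => ?_
    -- Only points closer to `y` than `x` can matter, and these lie in `V`.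
    rcases lt_or_ge (dist y z) (dist y x) with hlt | hle
    · have hzV : z ∈ V := by
        refine hball (Metric.mem_ball.2 ?_)
        have h1 := Metric.mem_ball.1 hy
        have h2 := dist_triangle_left z x y
        linarith
      have hz' : z ∈ A ∩ V := hAB ▸ ⟨hz, hzV⟩
      exact Metric.infDist_le_dist_of_mem hz'.1
    · exact (Metric.infDist_le_dist_of_mem hA).trans hle
  filter_upwards [Metric.ball_mem_nhds x (half_pos hr)] with y hy
  exact le_antisymm (key hS hS' h y hy) (key hS' hS h.symm y hy)

theorem setOf_realMax_nonpos (ha : Continuous a) (hb : Continuous b) :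
    {y | realMax a b y ≤ 0} = {y | ∀ t, inner ℝ (a t) y ≤ b t} := by
  ext y
  exact ⟨fun h t => by have := le_realMax ha hb y t; simp only [Set.mem_ofPred_eq] at h; linarith,
    fun h => ciSup_le fun t => sub_nonpos.2 (h t)⟩

theorem ebm_eq_ebm_activePart (ha : Continuous a) (hb : Continuous b) {x : E}
    (hx : realMax a b x = 0) (hreg : LocalRegularity a b x) :
    ebm (maxFun a b) x = ebm (maxFun (activePart a b x) (fun _ => 0)) 0 := by
  have : CompactSpace (activeSet a b x) :=
    isCompact_iff_compactSpace.1 (isClosed_activeSet ha hb x).isCompact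
  have : Nonempty (activeSet a b x) := (activeSet_nonempty ha hb x).to_subtype
  have hc := continuous_activePart (b := b) ha x
  have h0 : Continuous fun _ : activeSet a b x => (0 : ℝ) := continuous_const
  have hσ0 : realMax (activePart a b x) (fun _ => 0) 0 = 0 := realMax_zero_apply_zero
  set σ := realMax (activePart a b x) (fun _ => 0) with hσ
  have hK : {w | ∀ t ∈ activeSet a b x, inner ℝ (a t) w ≤ 0} = {w | σ w ≤ 0} := by
    ext w
    exact ⟨fun h => realMax_zero_le fun t => h t t.2,
      fun h t ht => (inner_le_realMax_zero hc w ⟨t, ht⟩).trans h⟩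
  obtain ⟨V, hV, hSV⟩ := hreg
  rw [← setOf_realMax_nonpos ha hb, hK] at hSV
  have hdist : ∀ᶠ y in 𝓝 x, Metric.infDist y {z | realMax a b z ≤ 0} =
      Metric.infDist (y - x) {w | σ w ≤ 0} := by
    have hx' : x ∈ (fun w => x + w) '' {w | σ w ≤ 0} := ⟨0, hσ0.le, add_zero x⟩
    filter_upwards [eventually_infDist_eq hV (S := {z | realMax a b z ≤ 0}) hx.le hx' hSV]
      with y hy
    have h1 := Metric.infDist_image (isometry_add_left x) (t := {w | σ w ≤ 0}) (x := y - x)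
    rw [hy, ← h1, add_sub_cancel]
  have hconst : ∀ τ : ℝ≥0, IsErrorBoundConst (maxFun a b) x τ ↔
      IsErrorBoundConst (maxFun (activePart a b x) (fun _ => 0)) 0 τ := by
    intro τ
    rw [isErrorBoundConst_maxFun_iff ha hb hx.le, isErrorBoundConst_maxFun_iff hc h0 hσ0.le]
    -- The bound for φ near `x` gives a global one for σ: it is applied at `x + s • w` and divided
    -- by `s`.
    refine and_congr_right fun _ => ⟨fun h => Eventually.of_forall fun w => ?_, fun h => ?_⟩
    · refine le_of_forall_gt_imp_ge_of_dense fun r hr => ?_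
      have hr0 : 0 < r := (le_max_right _ _).trans_lt hr
      have hact : ∀ t ∈ activeSet a b x, inner ℝ (a t) w < r := fun t ht =>
        (inner_le_realMax_zero hc w ⟨t, ht⟩).trans_lt ((le_max_left _ _).trans_lt hr)
      have hlim : Tendsto (fun s : ℝ => x + s • w) (𝓝[>] 0) (𝓝 x) := by
        have : Continuous fun s : ℝ => x + s • w := by fun_prop
        simpa using (this.tendsto 0).mono_left nhdsWithin_le_nhds
      obtain ⟨s, ⟨⟨hs1, hs2⟩, hs3⟩, hs⟩ := ((hlim.eventually (h.and hdist)).and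
        (eventually_realMax_add_smul_le ha hb hact) |>.and self_mem_nhdsWithin).exists
      have hs0 : 0 < s := hs
      rw [hs2, add_sub_cancel_left] at hs1
      have hscale : s * Metric.infDist w {w | σ w ≤ 0} ≤
          Metric.infDist (s • w) {w | σ w ≤ 0} := by
        refine (Metric.le_infDist (s := {w | σ w ≤ 0}) ⟨0, hσ0.le⟩).2 fun z hz => ?_
        have hz' : s⁻¹ • z ∈ {w | σ w ≤ 0} := by
          refine realMax_zero_le fun t => ?_
          rw [inner_smul_right]
          exact mul_nonpos_of_nonneg_of_nonpos (inv_nonneg.2 hs0.le)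
            ((inner_le_realMax_zero hc z t).trans hz)
        have h1 := mul_le_mul_of_nonneg_left
          (Metric.infDist_le_dist_of_mem (x := w) hz') hs0.le
        have h2 := dist_smul₀ s w (s⁻¹ • z)
        rw [smul_inv_smul₀ hs0.ne', Real.norm_of_nonneg hs0.le] at h2
        rwa [h2]
      have h1 : max (realMax a b (x + s • w)) 0 ≤ s * r :=
        max_le (by linarith) (mul_nonneg hs0.le hr0.le)
      have h2 := mul_le_mul_of_nonneg_left hscale τ.2
      refine le_of_mul_le_mul_left ?_ hs0
      calc s * (τ * Metric.infDist w {w | σ w ≤ 0})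
          = τ * (s * Metric.infDist w {w | σ w ≤ 0}) := by ring
        _ ≤ s * r := h2.trans (hs1.trans h1)
    · have hlim : Tendsto (fun y => y - x) (𝓝 x) (𝓝 0) := by
        simpa using (continuous_sub_right x).tendsto x
      filter_upwards [hlim.eventually h, hdist] with y hy hyd
      rw [hyd]
      -- Since φ(x) = 0, active indices give σ(y - x) ≤ φ(y).
      refine hy.trans (max_le_max_right 0 (realMax_zero_le fun t => ?_))
      have h1 := (mem_activeSet ha hb).1 t.2
      have h2 := le_realMax ha hb y t
      change inner ℝ (a t) (y - x) ≤ _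
      rw [inner_sub_right]
      linarith
  simp only [ebm, hconst]

theorem ebm_eq_top_of_realMax_neg (ha : Continuous a) (hb : Continuous b) {x : E}
    (hx : realMax a b x < 0) : ebm (maxFun a b) x = ⊤ := by
  refine ENNReal.eq_top_of_forall_nnreal_le fun r => ?_
  -- The constant `r + 1` replaces `r` because error bound constants must be positive.
  refine le_trans (ENNReal.coe_le_coe.2 (le_add_of_nonneg_right zero_le_one))
    (le_iSup₂_of_le (r + 1) ((isErrorBoundConst_maxFun_iff ha hb hx.le).2 ⟨by positivity, ?_⟩)
      le_rfl)
  filter_upwards [((continuous_realMax ha hb).tendsto x).eventually (gt_mem_nhds hx)] with y hy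
  rw [Metric.infDist_zero_of_mem (show y ∈ {z | realMax a b z ≤ 0} from hy.le), mul_zero]
  exact le_max_right _ _

/-- At a point with slack the regularity condition forces the active gradients to vanish, so the
union over the face index sets is empty. -/
theorem infEDist_faces_eq_top_of_realMax_neg (ha : Continuous a) (hb : Continuous b) {x : E}
    (hx : realMax a b x < 0) (hreg : LocalRegularity a b x) :
    Metric.infEDist 0 (⋃ T' ∈ faceIndexSets a b x, convexHull ℝ (a '' T')) = ⊤ := by
  obtain ⟨V, hV, hSV⟩ := hreg
  -- The slack allows a small step along `a t`; regularity puts this step in the cone, so `s * ‖a t‖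
  -- ^ 2 ≤ 0`.
  have hzero : ∀ t ∈ activeSet a b x, a t = 0 := by
    intro t ht
    have hlim : Tendsto (fun s : ℝ => x + s • a t) (𝓝[>] 0) (𝓝 x) := by
      have : Continuous fun s : ℝ => x + s • a t := by fun_prop
      simpa using (this.tendsto 0).mono_left nhdsWithin_le_nhds
    obtain ⟨s, ⟨hs1, hs2⟩, hs⟩ := (hlim.eventually
      ((((continuous_realMax ha hb).tendsto x).eventually (gt_mem_nhds hx)).and hV)
      |>.and self_mem_nhdsWithin).exists
    have hs0 : 0 < s := hs
    rw [← setOf_realMax_nonpos ha hb] at hSV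
    have hmem : x + s • a t ∈ {y | realMax a b y ≤ 0} ∩ V := ⟨hs1.le, hs2⟩
    rw [hSV] at hmem
    obtain ⟨⟨w, hw, hweq⟩, -⟩ := hmem
    have h1 := hw t ht
    rw [add_left_cancel hweq, inner_smul_right] at h1
    exact real_inner_self_nonpos.1 (nonpos_of_mul_nonpos_right h1 hs0)
  have hempty : ⋃ T' ∈ faceIndexSets a b x, convexHull ℝ (a '' T') = ∅ := by
    simp only [Set.iUnion_eq_empty]
    rintro T' ⟨hT', w, hw, -⟩
    have : T' = ∅ := Set.eq_empty_of_forall_notMem fun t ht => by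
      have := hw t ht
      rw [hzero t (hT' ht), inner_zero_left] at this
      exact zero_ne_one this
    simp [this]
  rw [hempty, Metric.infEDist_empty]

end Regularity

end ErrorBound

theorem mainTheorem7 {n : ℕ} {T : Type*} [TopologicalSpace T] [CompactSpace T] [Nonempty T]
    (a : T → EuclideanSpace ℝ (Fin n)) (b : T → ℝ) (ha : Continuous a) (hb : Continuous b)
    (x : EuclideanSpace ℝ (Fin n)) (hx : ∀ t, inner ℝ (a t) x ≤ b t)
    (hreg : ErrorBound.LocalRegularity a b x) :
    (ErrorBound.maxFun a b x = 0 →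
      Metric.infEDist 0 (ErrorBound.outerSubdiff (ErrorBound.maxFun a b) x) =
        ErrorBound.ebm (ErrorBound.maxFun a b) x) ∧
    ErrorBound.ebm (ErrorBound.maxFun a b) x =
      Metric.infEDist 0 (ErrorBound.outerSubdiff
        (ErrorBound.supportFun (ErrorBound.subdiff (ErrorBound.maxFun a b) x)) 0) ∧
    Metric.infEDist 0 (ErrorBound.outerSubdiff
        (ErrorBound.supportFun (ErrorBound.subdiff (ErrorBound.maxFun a b) x)) 0) =
      Metric.infEDist 0 (⋃ T' ∈ ErrorBound.faceIndexSets a b x, convexHull ℝ (a '' T')) := by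
  open ErrorBound in
  have hle : realMax a b x ≤ 0 := (Set.ext_iff.1 (setOf_realMax_nonpos ha hb) x).2 hx
  rw [subdiff_maxFun ha hb, supportFun_faceHull]
  refine ⟨fun h => ?_, ?_, infEDist_outerSubdiff_activePart ha hb x⟩
  · rw [maxFun_eq_coe ha hb, EReal.coe_eq_zero] at h
    exact (ebm_eq_infEDist_outerSubdiff ha hb h).symm
  · rcases hle.lt_or_eq with hneg | h0
    · rw [infEDist_outerSubdiff_activePart ha hb, ebm_eq_top_of_realMax_neg ha hb hneg,
        infEDist_faces_eq_top_of_realMax_neg ha hb hneg hreg]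
    · have : CompactSpace (activeSet a b x) :=
        isCompact_iff_compactSpace.1 (isClosed_activeSet ha hb x).isCompact
      have : Nonempty (activeSet a b x) := (activeSet_nonempty ha hb x).to_subtype
      rw [ebm_eq_ebm_activePart ha hb h0 hreg]
      exact ebm_eq_infEDist_outerSubdiff (continuous_activePart ha x) continuous_const
        realMax_zero_apply_zero
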